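/- Let $N\ge 2$ and let $\mathcal G$ be a connected undirected weighted graph on the agents $1,\dots,N$, with symmetric weights $a_{ij}=a_{ji}\ge 0$ ($a_{ij}>0$ exactly when there is an edge between $i$ and $j$). Let $\mathsf L=\operatorname{diag}\bigl(\sum_j a_{ji}\bigr)_i-(a_{ij})$ be its Laplacian matrix, let $\lambda_2$ and $\lambda_N$ be the smallest and the largest nonzero eigenvalue of $\mathsf L$, and put $\lambda_r=\lambda_2/\lambda_N\in(0,1]$. Each agent $i$ has a constant reference signal $\mathsf u^i\in\mathbb R$; put $\mathsf u^{\mathrm{avg}}=\frac1N\sum_{i=1}^N\mathsf u^i$. Consider the following four discrete-time algorithms, run for $k=0,1,2,\dots$ and $i=1,\dots,N$. 1. (Plain.) $p^i_{k+1}=p^i_k+k_I\sum_j a_{ij}(x^i_k-x^j_k)$, $\;x^i_k=\mathsf u^i-p^i_k$, initialized with $\sum_i p^i_0=0$, where $$\rho=\frac{\lambda_N-\lambda_2}{\lambda_N+\lambda_2},\qquad k_I=\frac{2}{\lambda_2+\lambda_N}.$$ 2. (Accelerated.) $p^i_{k+1}=(1+\rho^2)p^i_k-\rho^2p^i_{k-1}+k_I\sum_j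 a_{ij}(x^i_k-x^j_k)$, $\;x^i_k=\mathsf u^i-p^i_k$, initialized with $\sum_i p^i_0=\sum_i p^i_{-1}=0$, where $$\rho=\frac{\sqrt{\lambda_N}-\sqrt{\lambda_2}}{\sqrt{\lambda_N}+\sqrt{\lambda_2}},\qquad k_I=\frac{4}{(\sqrt{\lambda_2}+\sqrt{\lambda_N})^2}.$$ 3. (Proportional-integral.) $q^i_{k+1}=\rho q^i_k+k_p\sum_j a_{ij}\bigl((x^i_k-x^j_k)+(p^i_k-p^j_k)\bigr)$, $\;p^i_{k+1}=p^i_k+k_I\sum_j a_{ij}(x^i_k-x^j_k)$, $\;x^i_k=\mathsf u^i-q^i_k$, with arbitrary initial values $p^i_0,q^i_0\in\mathbb R$, where $$\rho=\begin{cases}\dfrac{8-8\lambda_r+\lambda_r^2}{8-\lambda_r^2},&0<\lambda_r\le 3-\sqrt5,\\[2mm]\dfrac{\sqrt{(1-\lambda_r)(4+\lambda_r^2(5-\lambda_r))}-\lambda_r(1-\lambda_r)}{2(1+\lambda_r^2)},&3-\sqrt5<\lambda_r\le1,\end{cases}\qquad k_I=\frac{1-\rho}{\lambda_2},\qquad k_p=\frac1{\lambda_N}\,\frac{\rho(1-\rho)\lambda_r}{\rho+\lambda_r-1},$$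 and where, for $\lambda_r=1$, the last expression (which reads $0/0$) is replaced by its limit $k_p=1/\lambda_N$ as $\lambda_r\to1$. 4. (Accelerated proportional-integral.) $q^i_{k+1}=2\rho q^i_k-\rho^2q^i_{k-1}+k_p\sum_j a_{ij}\bigl((x^i_k-x^j_k)+(p^i_k-p^j_k)\bigr)$, $\;p^i_{k+1}=(1+\rho^2)p^i_k-\rho^2p^i_{k-1}+k_I\sum_j a_{ij}(x^i_k-x^j_k)$, $\;x^i_k=\mathsf u^i-q^i_k$, with arbitrary initial values $p^i_0,p^i_{-1},q^i_0,q^i_{-1}\in\mathbb R$, where $$\rho=\begin{cases}\dfrac{6-2\sqrt{1-\lambda_r}+\lambda_r-4\sqrt{2-2\sqrt{1-\lambda_r}+\lambda_r}}{2+2\sqrt{1-\lambda_r}-\lambda_r},&0<\lambda_r\le 2(\sqrt2-1),\\[2mm]\dfrac{-3-2\sqrt{1-\lambda_r}+\lambda_r+2\sqrt{2+2\sqrt{1-\lambda_r}-\lambda_r}}{-1-2\sqrt{1-\lambda_r}+\lambda_r},&2(\sqrt2-1)<\lambda_r\le1,\end{cases}\qquad k_I=\frac{(1-\rho)^2}{\lambda_2},\qquad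 k_p=\bigl(2+2\sqrt{1-\lambda_r}-\lambda_r\bigr)k_I,$$ and where, for $\lambda_r=1$, the second expression for $\rho$ (which reads $0/0$) is replaced by its limit $\rho=0$ as $\lambda_r\to1$. Then, for each of the four algorithms, all agreement states $x^i_k$ converge to $\mathsf u^{\mathrm{avg}}$ exponentially with rate $\rho$. This means that $0\le\rho<1$; that, for all admissible initial values, $x^i_k\to\mathsf u^{\mathrm{avg}}$ as $k\to\infty$ and $|x^i_k-\mathsf u^{\mathrm{avg}}|=O(r^k)$ for every $i$ and every $r>\rho$; and that $\rho$ is the exact worst-case rate: for every $0\le r<\rho$ there are admissible initial values and an agent $i$ for which $|x^i_k-\mathsf u^{\mathrm{avg}}|$ is not $O(r^k)$. -/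

import Mathlib

open Filter Topology

noncomputable section

namespace ConsensusDT

/-- A weighted undirected graph on the agents `1, …, N`, given by its weighted adjacency matrix
`a`: there is an edge between `i` and `j` exactly when `0 < a i j`. -/
structure WeightedGraph (N : ℕ) where
  a : Matrix (Fin N) (Fin N) ℝ
  nonneg : ∀ i j, 0 ≤ a i j
  symm : ∀ i j, a i j = a j i

namespace WeightedGraph

variable {N : ℕ} (G : WeightedGraph N)

/-- The underlying simple graph (self-loops play no role in connectivity). -/
def toSimpleGraph : SimpleGraph (Fin N) :=
  SimpleGraph.fromRel fun i j => 0 < G.a i j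

/-- The graph is connected. -/
def Connected : Prop := G.toSimpleGraph.Connected

/-- The Laplacian matrix: the diagonal matrix of weighted degrees minus the adjacency matrix. -/
def laplacian : Matrix (Fin N) (Fin N) ℝ :=
  Matrix.diagonal (fun i => ∑ j, G.a j i) - G.a

/-- The set of nonzero eigenvalues of the Laplacian. -/
def nonzeroEigenvalues : Set ℝ :=
  {μ | μ ≠ 0 ∧ Module.End.HasEigenvalue (Matrix.toLin' G.laplacian) μ}

/-! ### The four algorithms

Each definition gives the set of all sequences of agreement states `x k i` that the algorithm can
produce for a reference signal `u k i`, over all the admissible initial conditions. The accelerated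
algorithms use the internal states at time `-1` as well, so that their internal states are
indexed by `ℤ`; only the values at the times `k ≥ -1` matter. -/

/-- Plain algorithm, with step size `kI`, initialized with `∑ p i 0 = 0`. -/
def plainOutputs (kI : ℝ) (u : ℕ → Fin N → ℝ) : Set (ℕ → Fin N → ℝ) :=
  {x | ∃ p : ℕ → Fin N → ℝ,
    ∑ i, p 0 i = 0 ∧
    ∀ k i,
      p (k + 1) i = p k i + kI * ∑ j, G.a i j * (x k i - x k j) ∧
      x k i = u k i - p k i}

/-- Accelerated algorithm, with both initial integrator states of average zero. -/
def acceleratedOutputs (ρ kI : ℝ) (u : ℕ → Fin N → ℝ) : Set (ℕ → Fin N → ℝ) :=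
  {x | ∃ p : ℤ → Fin N → ℝ,
    ∑ i, p 0 i = 0 ∧ ∑ i, p (-1) i = 0 ∧
    ∀ (k : ℕ) i,
      p (k + 1) i = (1 + ρ ^ 2) * p k i - ρ ^ 2 * p (k - 1) i
        + kI * ∑ j, G.a i j * (x k i - x k j) ∧
      x k i = u k i - p k i}

/-- Proportional-integral algorithm, with arbitrary initial conditions. -/
def piOutputs (ρ kI kp : ℝ) (u : ℕ → Fin N → ℝ) : Set (ℕ → Fin N → ℝ) :=
  {x | ∃ p q : ℕ → Fin N → ℝ,
    ∀ k i,
      q (k + 1) i = ρ * q k i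
        + kp * ∑ j, G.a i j * ((x k i - x k j) + (p k i - p k j)) ∧
      p (k + 1) i = p k i + kI * ∑ j, G.a i j * (x k i - x k j) ∧
      x k i = u k i - q k i}

/-- Accelerated proportional-integral algorithm, with arbitrary initial conditions. -/
def acceleratedPiOutputs (ρ kI kp : ℝ) (u : ℕ → Fin N → ℝ) : Set (ℕ → Fin N → ℝ) :=
  {x | ∃ p q : ℤ → Fin N → ℝ,
    ∀ (k : ℕ) i,
      q (k + 1) i = 2 * ρ * q k i - ρ ^ 2 * q (k - 1) i
        + kp * ∑ j, G.a i j * ((x k i - x k j) + (p k i - p k j)) ∧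
      p (k + 1) i = (1 + ρ ^ 2) * p k i - ρ ^ 2 * p (k - 1) i
        + kI * ∑ j, G.a i j * (x k i - x k j) ∧
      x k i = u k i - q k i}

end WeightedGraph

/-! ### The parameters, as functions of the smallest (`l2`) and the largest (`lN`) nonzero
Laplacian eigenvalue -/

/-- Plain algorithm: convergence rate. -/
def plainRho (l2 lN : ℝ) : ℝ := (lN - l2) / (lN + l2)

/-- Plain algorithm: integral gain. -/
def plainKI (l2 lN : ℝ) : ℝ := 2 / (l2 + lN)

/-- Accelerated algorithm: convergence rate. -/
def acceleratedRho (l2 lN : ℝ) : ℝ := (√lN - √l2) / (√lN + √l2)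

/-- Accelerated algorithm: integral gain. -/
def acceleratedKI (l2 lN : ℝ) : ℝ := 4 / (√l2 + √lN) ^ 2

/-- Proportional-integral algorithm: convergence rate, as a function of `r = l2 / lN`. -/
def piRhoOfRatio (r : ℝ) : ℝ :=
  if r ≤ 3 - √5 then (8 - 8 * r + r ^ 2) / (8 - r ^ 2)
  else (√((1 - r) * (4 + r ^ 2 * (5 - r))) - r * (1 - r)) / (2 * (1 + r ^ 2))

/-- Proportional-integral algorithm: convergence rate. -/
def piRho (l2 lN : ℝ) : ℝ := piRhoOfRatio (l2 / lN)

/-- Proportional-integral algorithm: integral gain. -/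
def piKI (l2 lN : ℝ) : ℝ := (1 - piRho l2 lN) / l2

/-- Proportional-integral algorithm: proportional gain. When `l2 = lN`, the general expression
reads `0 / 0` and is replaced by its limit `1 / lN` as `l2 / lN` tends to `1`. -/
def piKp (l2 lN : ℝ) : ℝ :=
  if l2 = lN then 1 / lN
  else 1 / lN * (piRho l2 lN * (1 - piRho l2 lN) * (l2 / lN) / (piRho l2 lN + l2 / lN - 1))

/-- Accelerated proportional-integral algorithm: convergence rate, as a function of
`r = l2 / lN`. When `r = 1`, the second expression reads `0 / 0` and is replaced by its limit
`0` as `r` tends to `1`. -/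
def acceleratedPiRhoOfRatio (r : ℝ) : ℝ :=
  if r ≤ 2 * (√2 - 1) then
    (6 - 2 * √(1 - r) + r - 4 * √(2 - 2 * √(1 - r) + r)) / (2 + 2 * √(1 - r) - r)
  else if r = 1 then 0
  else
    (-3 - 2 * √(1 - r) + r + 2 * √(2 + 2 * √(1 - r) - r)) / (-1 - 2 * √(1 - r) + r)

/-- Accelerated proportional-integral algorithm: convergence rate. -/
def acceleratedPiRho (l2 lN : ℝ) : ℝ := acceleratedPiRhoOfRatio (l2 / lN)

/-- Accelerated proportional-integral algorithm: integral gain. -/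
def acceleratedPiKI (l2 lN : ℝ) : ℝ := (1 - acceleratedPiRho l2 lN) ^ 2 / l2

/-- Accelerated proportional-integral algorithm: proportional gain. -/
def acceleratedPiKp (l2 lN : ℝ) : ℝ :=
  (2 + 2 * √(1 - l2 / lN) - l2 / lN) * acceleratedPiKI l2 lN

/-! ### Convergence -/

/-- The average of the reference values of the agents. -/
def average {N : ℕ} (u : Fin N → ℝ) : ℝ := (∑ i, u i) / N

/-- All the agreement states of all the runs in `X` converge to `c` exponentially with rate `ρ`:
`0 ≤ ρ < 1`, every error is `O(r ^ k)` for every `r > ρ`, and `ρ` is the rate over the runs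
in `X` and not just a bound for it: for no `r < ρ` are all the errors `O(r ^ k)`.
(An error such as `k * ρ ^ k`, caused by a repeated pole of modulus `ρ`, has rate `ρ`.) -/
def ConvergesExpWithRate {N : ℕ} (X : Set (ℕ → Fin N → ℝ)) (c ρ : ℝ) : Prop :=
  (0 ≤ ρ ∧ ρ < 1) ∧
  (∀ x ∈ X, ∀ i, Tendsto (fun k => x k i) atTop (𝓝 c)) ∧
  (∀ x ∈ X, ∀ i, ∀ r, ρ < r → ∃ C : ℝ, ∀ k : ℕ, |x k i - c| ≤ C * r ^ k) ∧
  (∀ r, 0 ≤ r → r < ρ → ∃ x ∈ X, ∃ i, ∀ C : ℝ, ∃ k : ℕ, C * r ^ k < |x k i - c|)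

end ConsensusDT

end

/-!
Everything is linear, so each algorithm is projected onto an orthonormal basis of eigenvectors of
the Laplacian (`WeightedGraph.convergesExpWithRate_of_modes`). Since the graph is connected, the
eigenvalue `0` belongs to the all-ones direction alone
(`WeightedGraph.eq_of_laplacian_mulVec_eq_zero`), so its mode describes the mean of the errors; every
other mode has an eigenvalue `μ` in `[l2, lN]`, and the constant vector of the
average has no component along it.

* Plain: a mode is multiplied by `1 - kI * μ` in each step (`plain_multiplier`).
* Accelerated: a mode has characteristic polynomial `z ^ 2 - (1 + ρ ^ 2 - kI * μ) * z + ρ ^ 2`, whose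
  roots have modulus `ρ` because `(1 - ρ) ^ 2 ≤ kI * μ ≤ (1 + ρ) ^ 2` (`accelerated_rootsInDisc`).
* Proportional-integral: with `a = kp * μ` and `b = kI * μ`, eliminating the integrator state leaves
  `(z - 1) * (z - ρ) + a * (z - 1) + a * b`, which satisfies the Jury conditions for the disc of
  radius `ρ` (`pi_rootsInDisc`).
* Accelerated proportional-integral: the quartic
  `(z - ρ) ^ 2 * (z - 1) * (z - ρ ^ 2) + a * z * (z - 1) * (z - ρ ^ 2) + a * b * z ^ 2` is invariant
  under `z ↦ ρ ^ 2 / z`, hence a quadratic in `w = z + ρ ^ 2 / z`. Its roots `w` are real and lie in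
  `[-2 * ρ, 2 * ρ]` (`acceleratedPi_roots`), so the quartic is a product of two factors
  `z ^ 2 - w * z + ρ ^ 2` with roots of modulus `ρ`.

That a recursion with all characteristic roots in the closed disc of radius `ρ` has solutions
`O(r ^ k)` for every `r > ρ` follows by peeling off one root at a time
(`HasRate.of_first_order`, `HasRate.of_second_order`).

The rate is attained because one mode can be made to decay exactly like `ρ ^ k`: the mode of `l2`,
where `1 - kI * l2 = ρ` or `kI * l2 = (1 - ρ) ^ 2`, in the first two algorithms, and the mean mode,
which has the characteristic root `ρ`, in the last two.
-/

namespace ConsensusDT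

/-! ### Exponential rates of sequences -/

/-- The sequence `y` decays exponentially with rate (at most) `ρ`: it is `O(r ^ k)` for every
`r > ρ`. -/
def HasRate {E : Type*} [NormedAddCommGroup E] (ρ : ℝ) (y : ℕ → E) : Prop :=
  ∀ r, ρ < r → ∃ C : ℝ, ∀ k : ℕ, ‖y k‖ ≤ C * r ^ k

theorem HasRate.shift {E : Type*} [NormedAddCommGroup E] {ρ : ℝ} {y : ℕ → E}
    (h : HasRate ρ y) : HasRate ρ (fun k => y (k + 1)) := by
  intro r hr
  obtain ⟨C, hC⟩ := h r hr
  exact ⟨C * r, fun k => (hC (k + 1)).trans_eq (by ring)⟩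

theorem HasRate.const_mul {ρ : ℝ} {y : ℕ → ℝ} (h : HasRate ρ y) (c : ℝ) :
    HasRate ρ (fun k => c * y k) := by
  intro r hr
  obtain ⟨C, hC⟩ := h r hr
  refine ⟨|c| * C, fun k => ?_⟩
  rw [norm_mul, Real.norm_eq_abs c, mul_assoc]
  exact mul_le_mul_of_nonneg_left (hC k) (abs_nonneg c)

theorem HasRate.sum {ι E : Type*} [NormedAddCommGroup E] {ρ : ℝ} (s : Finset ι) {y : ι → ℕ → E}
    (h : ∀ j ∈ s, HasRate ρ (y j)) : HasRate ρ (fun k => ∑ j ∈ s, y j k) := by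
  intro r hr
  choose! C hC using fun j hj => h j hj r hr
  refine ⟨∑ j ∈ s, C j, fun k => (norm_sum_le _ _).trans ?_⟩
  rw [Finset.sum_mul]
  exact Finset.sum_le_sum fun j hj => hC j hj k

theorem HasRate.zero {ρ : ℝ} : HasRate ρ (fun _ => (0 : ℝ)) :=
  fun _ _ => ⟨0, fun _ => by simp⟩

theorem HasRate.tendsto_zero {ρ : ℝ} {y : ℕ → ℝ} (h : HasRate ρ y) (h0 : 0 ≤ ρ) (h1 : ρ < 1) :
    Tendsto y atTop (𝓝 0) := by
  obtain ⟨C, hC⟩ := h ((ρ + 1) / 2) (by linarith)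
  refine squeeze_zero_norm hC ?_
  simpa using (tendsto_pow_atTop_nhds_zero_of_lt_one (r := (ρ + 1) / 2)
    (by linarith) (by linarith)).const_mul C

/-- A first-order recursion whose multiplier has modulus at most `ρ` preserves the rate `ρ` of its
forcing term. The multiplier may have modulus exactly `ρ`: the rate only concerns `r > ρ`. -/
theorem HasRate.of_first_order {ρ : ℝ} {α : ℂ} (hα : ‖α‖ ≤ ρ) {y g : ℕ → ℂ}
    (hg : HasRate ρ g) (hy : ∀ k, y (k + 1) = α * y k + g k) : HasRate ρ y := by
  intro r hr
  have hr0 : 0 < r := (norm_nonneg α).trans_lt (hα.trans_lt hr)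
  obtain ⟨C, hC⟩ := hg r hr
  -- The bound `D * r ^ k` propagates as soon as `‖y 0‖ ≤ D` and `ρ * D + C ≤ r * D`.
  set D := max ‖y 0‖ (C / (r - ρ)) with hD
  have hD0 : 0 ≤ D := (norm_nonneg _).trans (le_max_left _ _)
  have hD1 : C ≤ D * (r - ρ) := (div_le_iff₀ (by linarith)).1 (le_max_right _ _)
  refine ⟨D, fun k => ?_⟩
  induction k with
  | zero => simp [hD]
  | succ k ih =>
    calc ‖y (k + 1)‖ ≤ ‖α‖ * ‖y k‖ + ‖g k‖ := by
          rw [hy, ← norm_mul]; exact norm_add_le _ _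
      _ ≤ ρ * (D * r ^ k) + D * (r - ρ) * r ^ k := by
          refine add_le_add (mul_le_mul hα ih (norm_nonneg _) ((norm_nonneg α).trans hα))
            ((hC k).trans (by gcongr))
      _ = D * r ^ (k + 1) := by ring

/-- The two roots of `z ^ 2 - B * z + C` lie in the closed disc of radius `ρ`. -/
def RootsInDisc (ρ B C : ℝ) : Prop :=
  ∃ α β : ℂ, α + β = B ∧ α * β = C ∧ ‖α‖ ≤ ρ ∧ ‖β‖ ≤ ρ

theorem HasRate.of_second_order {ρ B C : ℝ} (h : RootsInDisc ρ B C) {y g : ℕ → ℝ}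
    (hg : HasRate ρ g) (hy : ∀ k, y (k + 2) = B * y (k + 1) - C * y k + g k) : HasRate ρ y := by
  obtain ⟨α, β, hs, hp, hα, hβ⟩ := h
  have hg' : HasRate ρ (fun k => (g k : ℂ)) := fun r hr => by simpa using hg r hr
  have h1 : HasRate ρ (fun k => (y (k + 1) : ℂ) - β * y k) := by
    refine HasRate.of_first_order hα hg' fun k => ?_
    rw [hy, Complex.ofReal_add, Complex.ofReal_sub, Complex.ofReal_mul, Complex.ofReal_mul,
      ← hs, ← hp]
    ring
  have h2 : HasRate ρ (fun k => (y k : ℂ)) := HasRate.of_first_order hβ h1 fun k => by ring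
  exact fun r hr => by simpa using h2 r hr

/-- A real quadratic with real roots, nonnegative at `±M` and with vertex in `[-M, M]`, has its
roots in `[-M, M]`. -/
theorem exists_real_roots {M B C : ℝ} (hd : 0 ≤ B ^ 2 - 4 * C) (hB : |B| ≤ 2 * M)
    (h1 : 0 ≤ M ^ 2 - B * M + C) (h2 : 0 ≤ M ^ 2 + B * M + C) :
    ∃ a b : ℝ, a + b = B ∧ a * b = C ∧ |a| ≤ M ∧ |b| ≤ M := by
  have hB' := abs_le.1 hB
  have hs := Real.sq_sqrt hd
  have hs0 := Real.sqrt_nonneg (B ^ 2 - 4 * C)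
  set s := √(B ^ 2 - 4 * C)
  have hle1 : s ≤ 2 * M - B := abs_le_of_sq_le_sq' (by nlinarith) (by linarith) |>.2
  have hle2 : s ≤ 2 * M + B := abs_le_of_sq_le_sq' (by nlinarith) (by linarith) |>.2
  refine ⟨(B + s) / 2, (B - s) / 2, by ring, by linear_combination -hs / 4, ?_, ?_⟩ <;>
    rw [abs_le] <;> constructor <;> linarith

/-- The Jury stability criterion for a real quadratic and the closed disc of radius `ρ`. -/
theorem rootsInDisc_of_jury {ρ B C : ℝ} (hρ : 0 ≤ ρ) (hB : |B| ≤ 2 * ρ) (hC : C ≤ ρ ^ 2)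
    (h1 : 0 ≤ ρ ^ 2 - B * ρ + C) (h2 : 0 ≤ ρ ^ 2 + B * ρ + C) : RootsInDisc ρ B C := by
  rcases le_total 0 (B ^ 2 - 4 * C) with hd | hd
  · obtain ⟨a, b, hs, hp, ha, hb⟩ := exists_real_roots hd hB h1 h2
    refine ⟨a, b, ?_, ?_, ?_, ?_⟩
    · rw [← hs, Complex.ofReal_add]
    · rw [← hp, Complex.ofReal_mul]
    · simpa using ha
    · simpa using hb
  · -- Two conjugate roots, of squared modulus `C`.
    have hs := Real.sq_sqrt (show 0 ≤ 4 * C - B ^ 2 by linarith)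
    set s := √(4 * C - B ^ 2)
    have key : ∀ t : ℝ, t ^ 2 = s ^ 2 → ‖(⟨B / 2, t / 2⟩ : ℂ)‖ ≤ ρ := by
      intro t ht
      refine abs_le_of_sq_le_sq' ?_ hρ |>.2
      rw [← Complex.normSq_eq_norm_sq, Complex.normSq_mk]
      nlinarith
    refine ⟨⟨B / 2, s / 2⟩, ⟨B / 2, (-s) / 2⟩, ?_, ?_, key _ rfl, key _ (by ring)⟩
    · apply Complex.ext <;> simp; ring
    · apply Complex.ext <;> simp
      · linear_combination hs / 4
      · ring

/-! ### Existence of runs -/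

/-- A second-order recursion has a run with prescribed states at the times `-1` and `0`. Only the
times `k ≥ -1` matter. -/
theorem exists_int_recursion {S : Type*} (f : S → S → S) (a b : S) :
    ∃ s : ℤ → S, s (-1) = a ∧ s 0 = b ∧ ∀ k : ℕ, s (k + 1) = f (s k) (s (k - 1)) := by
  let P : ℕ → S × S := fun n => Nat.rec (a, b) (fun _ q => (q.2, f q.2 q.1)) n
  refine ⟨fun k => (P (k + 1).toNat).1, rfl, rfl, fun k => ?_⟩
  have h1 : ((k : ℤ) + 1 + 1).toNat = k + 2 := by omega
  have h2 : ((k : ℤ) + 1).toNat = k + 1 := by omega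
  have h3 : ((k : ℤ) - 1 + 1).toNat = k := by omega
  simp only [h1, h2, h3]
  rfl

/-! ### Laplacian modes -/

namespace WeightedGraph

open Matrix

variable {N : ℕ} (G : WeightedGraph N)

theorem sum_eq_laplacian_mulVec (y : Fin N → ℝ) (i : Fin N) :
    ∑ j, G.a i j * (y i - y j) = (G.laplacian *ᵥ y) i := by
  rw [laplacian, Matrix.sub_mulVec, Pi.sub_apply, Matrix.mulVec_diagonal]
  simp only [mul_sub, Finset.sum_sub_distrib, ← Finset.sum_mul, G.symm i]
  simp [Matrix.mulVec, dotProduct, G.symm i]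

theorem laplacian_isHermitian : G.laplacian.IsHermitian := by
  have h : G.aᵀ = G.a := by ext i j; exact G.symm j i
  rw [Matrix.IsHermitian, Matrix.conjTranspose_eq_transpose_of_trivial, laplacian,
    Matrix.transpose_sub, Matrix.diagonal_transpose, h]

theorem laplacian_mulVec_one : G.laplacian *ᵥ 1 = 0 := by
  ext i
  rw [← sum_eq_laplacian_mulVec]
  simp

/-- Coupling terms act on the component of the state along an eigenvector as the eigenvalue. -/
theorem dotProduct_laplacian_mulVec {v : Fin N → ℝ} {μ : ℝ} (hv : G.laplacian *ᵥ v = μ • v)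
    (y : Fin N → ℝ) : v ⬝ᵥ G.laplacian *ᵥ y = μ * (v ⬝ᵥ y) := by
  have h : G.laplacianᵀ = G.laplacian := by
    simpa [Matrix.IsHermitian, Matrix.conjTranspose_eq_transpose_of_trivial] using
      G.laplacian_isHermitian
  rw [Matrix.dotProduct_mulVec, ← Matrix.mulVec_transpose, h, hv, smul_dotProduct, smul_eq_mul]

theorem dotProduct_one_eq_zero {v : Fin N → ℝ} {μ : ℝ} (hv : G.laplacian *ᵥ v = μ • v)
    (hμ : μ ≠ 0) : v ⬝ᵥ 1 = 0 := by
  have h := G.dotProduct_laplacian_mulVec hv 1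
  rw [laplacian_mulVec_one, dotProduct_zero] at h
  exact (mul_eq_zero.1 h.symm).resolve_left hμ

/-- The Laplacian quadratic form is the weighted sum of squared differences along the edges. -/
theorem two_mul_dotProduct_laplacian (v : Fin N → ℝ) :
    2 * (v ⬝ᵥ G.laplacian *ᵥ v) = ∑ i, ∑ j, G.a i j * (v i - v j) ^ 2 := by
  have h1 : v ⬝ᵥ G.laplacian *ᵥ v = ∑ i, ∑ j, G.a i j * (v i * (v i - v j)) := by
    simp only [dotProduct, ← sum_eq_laplacian_mulVec, Finset.mul_sum]
    exact Finset.sum_congr rfl fun i _ => Finset.sum_congr rfl fun j _ => by ring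
  have h2 : v ⬝ᵥ G.laplacian *ᵥ v = ∑ i, ∑ j, G.a i j * (v j * (v j - v i)) := by
    rw [h1, Finset.sum_comm]
    exact Finset.sum_congr rfl fun i _ => Finset.sum_congr rfl fun j _ => by rw [G.symm]
  rw [two_mul]
  nth_rewrite 1 [h1]
  rw [h2, ← Finset.sum_add_distrib]
  refine Finset.sum_congr rfl fun i _ => ?_
  rw [← Finset.sum_add_distrib]
  exact Finset.sum_congr rfl fun j _ => by ring

theorem dotProduct_laplacian_nonneg (v : Fin N → ℝ) : 0 ≤ v ⬝ᵥ G.laplacian *ᵥ v := by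
  have h := G.two_mul_dotProduct_laplacian v
  have : 0 ≤ ∑ i, ∑ j, G.a i j * (v i - v j) ^ 2 :=
    Finset.sum_nonneg fun i _ => Finset.sum_nonneg fun j _ =>
      mul_nonneg (G.nonneg i j) (sq_nonneg _)
  linarith

theorem dotProduct_self_pos_of_ne_zero {v : Fin N → ℝ} (hv : v ≠ 0) : 0 < v ⬝ᵥ v :=
  lt_of_le_of_ne (Finset.sum_nonneg fun i _ => mul_self_nonneg (v i))
    fun h => hv (dotProduct_self_eq_zero.1 h.symm)

theorem mem_nonzeroEigenvalues_iff {μ : ℝ} :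
    μ ∈ G.nonzeroEigenvalues ↔ μ ≠ 0 ∧ ∃ v, v ≠ 0 ∧ G.laplacian *ᵥ v = μ • v := by
  refine and_congr_right fun _ => ⟨fun h => ?_, fun ⟨v, hv, h⟩ => ?_⟩
  · obtain ⟨v, hv⟩ := h.exists_hasEigenvector
    exact ⟨v, hv.2, by simpa using hv.apply_eq_smul⟩
  · exact Module.End.hasEigenvalue_of_hasEigenvector
      ⟨Module.End.mem_eigenspace_iff.2 (by simpa using h), hv⟩

theorem pos_of_mem_nonzeroEigenvalues {μ : ℝ} (h : μ ∈ G.nonzeroEigenvalues) : 0 < μ := by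
  obtain ⟨h0, v, hv, hv'⟩ := G.mem_nonzeroEigenvalues_iff.1 h
  have h1 := G.dotProduct_laplacian_nonneg v
  rw [hv', dotProduct_smul, smul_eq_mul] at h1
  exact lt_of_le_of_ne (nonneg_of_mul_nonneg_left h1 (dotProduct_self_pos_of_ne_zero hv)) h0.symm

/-- On a connected graph the kernel of the Laplacian consists of the constant vectors. -/
theorem eq_of_laplacian_mulVec_eq_zero (hG : G.Connected) {v : Fin N → ℝ}
    (hv : G.laplacian *ᵥ v = 0) (i j : Fin N) : v i = v j := by
  have h := G.two_mul_dotProduct_laplacian v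
  rw [hv, dotProduct_zero, mul_zero] at h
  have hnn : ∀ i j, 0 ≤ G.a i j * (v i - v j) ^ 2 := fun i j =>
    mul_nonneg (G.nonneg i j) (sq_nonneg _)
  have h0 : ∀ i j, G.a i j * (v i - v j) ^ 2 = 0 := fun i j =>
    (Finset.sum_eq_zero_iff_of_nonneg fun j _ => hnn i j).1
      ((Finset.sum_eq_zero_iff_of_nonneg fun i _ => Finset.sum_nonneg fun j _ => hnn i j).1
        h.symm i (Finset.mem_univ i)) j (Finset.mem_univ j)
  have hpos : ∀ i j, 0 < G.a i j → v i = v j := fun i j hij => by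
    have := (mul_eq_zero.1 (h0 i j)).resolve_left hij.ne'
    exact sub_eq_zero.1 (pow_eq_zero_iff two_ne_zero |>.1 this)
  have hadj : ∀ i j, G.toSimpleGraph.Adj i j → v i = v j := fun i j hij => by
    rcases (SimpleGraph.fromRel_adj _ i j).1 hij with ⟨-, hij | hij⟩
    · exact hpos i j hij
    · exact (hpos j i hij).symm
  obtain ⟨w⟩ := hG.preconnected i j
  induction w with
  | nil => rfl
  | cons hij _ ih => exact (hadj _ _ hij).trans ih

/-- If the component of `e` along the all-ones vector and along all Laplacian eigenvectors with
nonzero eigenvalue has rate `ρ`, then so has every coordinate of `e`. -/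
theorem hasRate_apply (hG : G.Connected) {ρ : ℝ} {e : ℕ → Fin N → ℝ}
    (h0 : HasRate ρ (fun k => ∑ i, e k i))
    (h1 : ∀ v μ, μ ∈ G.nonzeroEigenvalues → G.laplacian *ᵥ v = μ • v →
      HasRate ρ (fun k => v ⬝ᵥ e k)) (i : Fin N) : HasRate ρ (fun k => e k i) := by
  set hA := G.laplacian_isHermitian
  set b := hA.eigenvectorBasis
  have hrepr : ∀ k, e k i = ∑ j, b j i * ((b j : Fin N → ℝ) ⬝ᵥ e k) := by
    intro k
    have h := congrArg (fun w : EuclideanSpace ℝ (Fin N) => w i)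
      (b.sum_repr' (WithLp.toLp 2 (e k)))
    simp only [WithLp.ofLp_sum, Finset.sum_apply, WithLp.ofLp_smul, Pi.smul_apply,
      smul_eq_mul] at h
    rw [← h]
    refine Finset.sum_congr rfl fun j _ => ?_
    rw [mul_comm, EuclideanSpace.inner_eq_star_dotProduct]
    simp [dotProduct_comm]
  simp only [hrepr]
  refine HasRate.sum _ fun j _ => HasRate.const_mul ?_ _
  have hv : G.laplacian *ᵥ (b j : Fin N → ℝ) = hA.eigenvalues j • (b j : Fin N → ℝ) :=
    hA.mulVec_eigenvectorBasis j
  by_cases hμ : hA.eigenvalues j = 0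
  · rw [hμ, zero_smul] at hv
    have hc := G.eq_of_laplacian_mulVec_eq_zero hG hv
    have : ∀ k, (b j : Fin N → ℝ) ⬝ᵥ e k = b j i * ∑ l, e k l := fun k => by
      rw [dotProduct, Finset.mul_sum]
      exact Finset.sum_congr rfl fun l _ => by rw [hc l i]
    simp only [this]
    exact h0.const_mul _
  · refine h1 _ _ (G.mem_nonzeroEigenvalues_iff.2 ⟨hμ, _, ?_, hv⟩) hv
    intro hz
    exact b.orthonormal.ne_zero j ((WithLp.ofLp_eq_zero 2).1 hz)

end WeightedGraph

/-- If a linear functional of the error decays exactly like `ρ ^ k`, then for `r < ρ` some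
coordinate of the error is not `O(r ^ k)`. -/
theorem exists_not_isBigO {N : ℕ} {ρ r c : ℝ} (hr : 0 ≤ r) (hrρ : r < ρ) (hc : c ≠ 0)
    {e : ℕ → Fin N → ℝ} (w : Fin N → ℝ) (h : ∀ k, ∑ i, w i * e k i = c * ρ ^ k) :
    ∃ i, ∀ C : ℝ, ∃ k : ℕ, C * r ^ k < |e k i| := by
  by_contra! hcon
  choose C hC using hcon
  set D := ∑ i, |w i| * C i
  have hb : ∀ k, |c| * ρ ^ k ≤ D * r ^ k := fun k => by
    have hρk : 0 ≤ ρ ^ k := pow_nonneg (hr.trans hrρ.le) k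
    rw [← abs_of_nonneg hρk, ← abs_mul, ← h, Finset.sum_mul]
    refine (Finset.abs_sum_le_sum_abs _ _).trans (Finset.sum_le_sum fun i _ => ?_)
    rw [abs_mul, mul_assoc]
    exact mul_le_mul_of_nonneg_left (hC i k) (abs_nonneg _)
  have hρ : 0 < ρ := hr.trans_lt hrρ
  have hlim : Tendsto (fun k : ℕ => D * (r / ρ) ^ k) atTop (𝓝 0) := by
    simpa using (tendsto_pow_atTop_nhds_zero_of_lt_one (div_nonneg hr hρ.le)
      ((div_lt_one hρ).2 hrρ)).const_mul D
  have : |c| ≤ 0 := ge_of_tendsto' hlim fun k => by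
    rw [div_pow, ← mul_div_assoc, le_div_iff₀ (pow_pos hρ k)]
    exact hb k
  exact hc (abs_nonpos_iff.1 this)

open Matrix in
/-- Exponential convergence with rate `ρ`, reduced to single modes: an upper bound for each mode,
and (unless `ρ = 0`) one run with a mode that decays exactly like `ρ ^ k`. -/
theorem WeightedGraph.convergesExpWithRate_of_modes {N : ℕ} (G : WeightedGraph N)
    (hG : G.Connected) {u : Fin N → ℝ} {ρ : ℝ} {X : Set (ℕ → Fin N → ℝ)} (h0 : 0 ≤ ρ) (h1 : ρ < 1)
    (hsum : ∀ x ∈ X, HasRate ρ (fun k => 1 ⬝ᵥ x k - 1 ⬝ᵥ u))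
    (hmode : ∀ x ∈ X, ∀ v μ, μ ∈ G.nonzeroEigenvalues → G.laplacian *ᵥ v = μ • v →
      HasRate ρ (fun k => v ⬝ᵥ x k))
    (hlow : 0 < ρ → ∃ x ∈ X, ∃ w : Fin N → ℝ, ∃ c, c ≠ 0 ∧
      ∀ k, w ⬝ᵥ x k - w ⬝ᵥ (fun _ => average u) = c * ρ ^ k) :
    ConvergesExpWithRate X (average u) ρ := by
  have hN : (N : ℝ) ≠ 0 := by
    obtain ⟨i⟩ := hG.nonempty
    exact_mod_cast (Fin.pos i).ne'
  have key : ∀ x ∈ X, ∀ i, HasRate ρ (fun k => x k i - average u) := by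
    intro x hx
    refine G.hasRate_apply hG (e := fun k i => x k i - average u) ?_ ?_
    · have : ∀ k, ∑ i, (x k i - average u) = 1 ⬝ᵥ x k - 1 ⬝ᵥ u := fun k => by
        simp [average, dotProduct, Finset.sum_sub_distrib, mul_div_cancel₀ _ hN]
      simpa only [this] using hsum x hx
    · intro v μ hμ hv
      have hv1 := G.dotProduct_one_eq_zero hv hμ.1
      have : ∀ k, v ⬝ᵥ (fun i => x k i - average u) = v ⬝ᵥ x k := fun k => by
        have : (fun i => x k i - average u) = x k - average u • (1 : Fin N → ℝ) := by
          ext i; simp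
        rw [this, dotProduct_sub, dotProduct_smul, hv1, smul_zero, sub_zero]
      simpa only [this] using hmode x hx v μ hμ hv
  refine ⟨⟨h0, h1⟩, fun x hx i => ?_, fun x hx i => key x hx i, fun r hr hrρ => ?_⟩
  · simpa using ((key x hx i).tendsto_zero h0 h1).add_const (average u)
  · obtain ⟨x, hx, w, c, hc, h⟩ := hlow (hr.trans_lt hrρ)
    refine ⟨x, hx, exists_not_isBigO hr hrρ hc w fun k => ?_⟩
    rw [← h k]
    simp [dotProduct, mul_sub, Finset.sum_sub_distrib]

/-! ### Parameters of the plain and the accelerated algorithm -/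

theorem plain_multiplier {l2 lN μ : ℝ} (h2 : 0 < l2) (hμ : l2 ≤ μ) (hμN : μ ≤ lN) :
    |1 - plainKI l2 lN * μ| ≤ plainRho l2 lN := by
  have hs : 0 < l2 + lN := by linarith
  have h : 1 - plainKI l2 lN * μ = (l2 + lN - 2 * μ) / (l2 + lN) := by
    rw [plainKI]; field_simp
  rw [h, plainRho, abs_div, abs_of_pos hs, add_comm lN l2]
  gcongr
  rw [abs_le]
  constructor <;> linarith

theorem plainRho_nonneg {l2 lN : ℝ} (h2 : 0 < l2) (h : l2 ≤ lN) : 0 ≤ plainRho l2 lN :=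
  div_nonneg (by linarith) (by linarith)

theorem plainRho_lt_one {l2 lN : ℝ} (h2 : 0 < l2) (h : l2 ≤ lN) : plainRho l2 lN < 1 := by
  rw [plainRho, div_lt_one (by linarith)]
  linarith

/-- The mode of the smallest nonzero eigenvalue has multiplier exactly `ρ`. -/
theorem plain_multiplier_left {l2 lN : ℝ} (h2 : 0 < l2) (h : l2 ≤ lN) :
    1 - plainKI l2 lN * l2 = plainRho l2 lN := by
  have hs : l2 + lN ≠ 0 := (by linarith : 0 < l2 + lN).ne'
  have hs' : lN + l2 ≠ 0 := (by linarith : 0 < lN + l2).ne'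
  rw [plainKI, plainRho]
  field_simp
  ring

theorem rootsInDisc_of_abs_le {ρ w : ℝ} (hw : |w| ≤ 2 * ρ) : RootsInDisc ρ w (ρ ^ 2) := by
  have h0 : 0 ≤ ρ := by linarith [abs_nonneg w]
  have h := abs_le.1 hw
  refine rootsInDisc_of_jury h0 hw le_rfl ?_ ?_
  · nlinarith [mul_nonneg h0 (show 0 ≤ 2 * ρ - w by linarith)]
  · nlinarith [mul_nonneg h0 (show 0 ≤ 2 * ρ + w by linarith)]

section Accelerated

variable {l2 lN : ℝ}

theorem acceleratedRho_nonneg (h : l2 ≤ lN) : 0 ≤ acceleratedRho l2 lN :=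
  div_nonneg (sub_nonneg.2 (Real.sqrt_le_sqrt h)) (by positivity)

theorem acceleratedRho_lt_one (h2 : 0 < l2) : acceleratedRho l2 lN < 1 := by
  have := Real.sqrt_pos.2 h2
  have := Real.sqrt_nonneg lN
  rw [acceleratedRho, div_lt_one (by linarith)]
  linarith

theorem acceleratedKI_mul_left (h2 : 0 < l2) :
    acceleratedKI l2 lN * l2 = (1 - acceleratedRho l2 lN) ^ 2 := by
  have := Real.sqrt_pos.2 h2
  have := Real.sqrt_nonneg lN
  have ha := Real.sq_sqrt h2.le
  have hs : √l2 + √lN ≠ 0 := by positivity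
  have hs' : √lN + √l2 ≠ 0 := by positivity
  have h1 : 1 - acceleratedRho l2 lN = 2 * √l2 / (√l2 + √lN) := by
    rw [acceleratedRho]; field_simp; ring
  rw [h1, acceleratedKI, div_pow, mul_pow, ha]
  ring

theorem acceleratedKI_mul_right (h2 : 0 < l2) (h : l2 ≤ lN) :
    acceleratedKI l2 lN * lN = (1 + acceleratedRho l2 lN) ^ 2 := by
  have := Real.sqrt_pos.2 h2
  have := Real.sqrt_nonneg lN
  have ha := Real.sq_sqrt (h2.le.trans h)
  have hs : √l2 + √lN ≠ 0 := by positivity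
  have hs' : √lN + √l2 ≠ 0 := by positivity
  have h1 : 1 + acceleratedRho l2 lN = 2 * √lN / (√l2 + √lN) := by
    rw [acceleratedRho]; field_simp; ring
  rw [h1, acceleratedKI, div_pow, mul_pow, ha]
  ring

theorem accelerated_rootsInDisc (h2 : 0 < l2) {μ : ℝ} (hμ : l2 ≤ μ) (hμN : μ ≤ lN) :
    RootsInDisc (acceleratedRho l2 lN)
      (1 + acceleratedRho l2 lN ^ 2 - acceleratedKI l2 lN * μ) (acceleratedRho l2 lN ^ 2) := by
  have hk : 0 ≤ acceleratedKI l2 lN := by unfold acceleratedKI; positivity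
  have h3 := acceleratedKI_mul_left (lN := lN) h2
  have h4 := acceleratedKI_mul_right h2 (hμ.trans hμN)
  have h5 := mul_le_mul_of_nonneg_left hμ hk
  have h6 := mul_le_mul_of_nonneg_left hμN hk
  apply rootsInDisc_of_abs_le
  rw [abs_le]
  constructor <;> nlinarith

end Accelerated

/-! ### Parameters of the proportional-integral algorithm -/

/-- The properties of the rate as a function `ρ` of the eigenvalue ratio `r` on which the analysis
rests. The last one is the Jury condition at `-ρ`: its left-hand side is a quadratic in `τ` which
has a double root when `r ≤ 3 - √5`, and has `1 - ρ` as its larger root otherwise. -/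
theorem piRhoOfRatio_spec {r : ℝ} (h0 : 0 < r) (h1 : r ≤ 1) :
    0 ≤ piRhoOfRatio r ∧ piRhoOfRatio r < 1 ∧ (r < 1 → 0 < piRhoOfRatio r + r - 1) ∧
    piRhoOfRatio r * (1 + r) ≤ 1 ∧
    ∀ τ, 1 - piRhoOfRatio r ≤ τ →
      0 ≤ r ^ 2 * τ ^ 2 - r ^ 2 * (1 + piRhoOfRatio r) * τ
        + 2 * (1 + piRhoOfRatio r) * (piRhoOfRatio r + r - 1) := by
  have h5 := Real.sq_sqrt (show (0 : ℝ) ≤ 5 by norm_num)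
  have h5' : 2 < √5 := Real.lt_sqrt_of_sq_lt (by norm_num)
  by_cases hr : r ≤ 3 - √5
  · have hd : 0 < 8 - r ^ 2 := by nlinarith
    have hρ : piRhoOfRatio r = (8 - 8 * r + r ^ 2) / (8 - r ^ 2) := if_pos hr
    have hmul : piRhoOfRatio r * (8 - r ^ 2) = 8 - 8 * r + r ^ 2 := by
      rw [hρ, div_mul_cancel₀ _ hd.ne']
    generalize piRhoOfRatio r = ρ at hρ hmul ⊢
    have hpos : 0 < ρ + r - 1 := by
      have : (ρ + r - 1) * (8 - r ^ 2) = r ^ 2 * (2 - r) := by linear_combination hmul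
      exact pos_of_mul_pos_left (this ▸ mul_pos (by positivity) (by linarith)) hd.le
    refine ⟨by linarith, ?_, fun _ => hpos, ?_, fun τ _ => ?_⟩
    · rw [hρ, div_lt_one hd]
      nlinarith
    · rw [hρ, div_mul_eq_mul_div, div_le_one hd]
      nlinarith [mul_nonneg (sq_nonneg r) (show 0 ≤ 6 - r by linarith)]
    · have : r ^ 2 * τ ^ 2 - r ^ 2 * (1 + ρ) * τ + 2 * (1 + ρ) * (ρ + r - 1)
          = r ^ 2 * (τ - (1 + ρ) / 2) ^ 2 := by linear_combination (1 + ρ) / 4 * hmul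
      rw [this]
      positivity
  · have hρ : piRhoOfRatio r =
        (√((1 - r) * (4 + r ^ 2 * (5 - r))) - r * (1 - r)) / (2 * (1 + r ^ 2)) := if_neg hr
    have hD0 : 0 ≤ (1 - r) * (4 + r ^ 2 * (5 - r)) :=
      mul_nonneg (by linarith) (by nlinarith [mul_nonneg (sq_nonneg r) (show 0 ≤ 5 - r by linarith)])
    have hD := Real.sq_sqrt hD0
    have hDle : r * (1 - r) ≤ √((1 - r) * (4 + r ^ 2 * (5 - r))) :=
      Real.le_sqrt_of_sq_le (by nlinarith [mul_nonneg (sq_nonneg r) (sub_nonneg.2 h1)])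
    have hn : 0 ≤ piRhoOfRatio r := by
      rw [hρ]
      exact div_nonneg (by linarith) (by positivity)
    have hmul : 2 * (1 + r ^ 2) * piRhoOfRatio r + r * (1 - r)
        = √((1 - r) * (4 + r ^ 2 * (5 - r))) := by
      rw [hρ]; field_simp; ring
    rw [← hmul] at hD
    -- The rate is the nonnegative root of a quadratic.
    have hq : piRhoOfRatio r ^ 2 * (1 + r ^ 2) + piRhoOfRatio r * (r - r ^ 2) + r - 1 = 0 := by
      have h4 : 4 * (1 + r ^ 2) * (piRhoOfRatio r ^ 2 * (1 + r ^ 2)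
          + piRhoOfRatio r * (r - r ^ 2) + r - 1) = 0 := by linear_combination hD
      exact (mul_eq_zero.1 h4).resolve_left (by positivity)
    generalize piRhoOfRatio r = ρ at hn hq
    -- That quadratic increases on the nonnegative half-line, so `ρ` compares with a number `c` as
    -- the value at `c` compares with `0`.
    have hfac : ∀ c : ℝ, c ^ 2 * (1 + r ^ 2) + c * (r - r ^ 2) + r - 1
        = (c - ρ) * ((c + ρ) * (1 + r ^ 2) + (r - r ^ 2)) := fun c => by linear_combination hq
    have hrr : 0 ≤ r - r ^ 2 := by nlinarith
    have hle : ∀ c : ℝ, 0 < c → 0 ≤ c ^ 2 * (1 + r ^ 2) + c * (r - r ^ 2) + r - 1 → ρ ≤ c := by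
      intro c hc h
      rw [hfac] at h
      have : 0 < (c + ρ) * (1 + r ^ 2) + (r - r ^ 2) := by positivity
      linarith [nonneg_of_mul_nonneg_left h this]
    have h13 : ρ ≤ 1 / 3 := hle _ (by norm_num) (by nlinarith)
    refine ⟨hn, by linarith, fun hr1 => ?_, ?_, fun τ hτ => ?_⟩
    · by_contra! hc
      have h := hfac (1 - r)
      have h' : (1 - r) ^ 2 * (1 + r ^ 2) + (1 - r) * (r - r ^ 2) + r - 1
          = -((1 - r) * r ^ 3) := by ring
      have : 0 < (1 - r) * r ^ 3 := mul_pos (by linarith) (by positivity)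
      have : 0 ≤ (1 - r - ρ) * ((1 - r + ρ) * (1 + r ^ 2) + (r - r ^ 2)) :=
        mul_nonneg (by linarith) (add_nonneg (mul_nonneg (by linarith) (by positivity)) hrr)
      linarith
    · rw [← le_div_iff₀ (by linarith)]
      refine hle _ (by positivity) ?_
      have : (1 / (1 + r)) ^ 2 * (1 + r ^ 2) + 1 / (1 + r) * (r - r ^ 2) + r - 1
          = 2 * r ^ 2 / (1 + r) ^ 2 := by
        field_simp
        ring
      rw [this]
      positivity
    · have : r ^ 2 * τ ^ 2 - r ^ 2 * (1 + ρ) * τ + 2 * (1 + ρ) * (ρ + r - 1)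
          = r ^ 2 * ((τ - (1 - ρ)) * (τ - 2 * ρ)) := by linear_combination 2 * hq
      rw [this]
      exact mul_nonneg (sq_nonneg r) (mul_nonneg (by linarith) (by linarith))

theorem piRhoOfRatio_one : piRhoOfRatio 1 = 0 := by
  have h5 : 2 < √5 := Real.lt_sqrt_of_sq_lt (by norm_num)
  rw [piRhoOfRatio, if_neg (by linarith)]
  norm_num

theorem pi_rootsInDisc {l2 lN μ : ℝ} (h2 : 0 < l2) (hμ : l2 ≤ μ) (hμN : μ ≤ lN) :
    RootsInDisc (piRho l2 lN) (1 + piRho l2 lN - piKp l2 lN * μ)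
      (piRho l2 lN - piKp l2 lN * μ + piKp l2 lN * μ * (piKI l2 lN * μ)) := by
  have hN : 0 < lN := by linarith
  rcases eq_or_lt_of_le (hμ.trans hμN) with h | h
  · -- All nonzero eigenvalues coincide: both roots vanish.
    have hμ' : μ = l2 := by linarith
    have hρ : piRho l2 lN = 0 := by rw [piRho, h, div_self hN.ne', piRhoOfRatio_one]
    have hp : piKp l2 lN * μ = 1 := by
      rw [piKp, if_pos h, hμ', h, one_div_mul_cancel hN.ne']
    have hI : piKI l2 lN * μ = 1 := by
      rw [piKI, hρ, hμ', sub_zero, one_div_mul_cancel h2.ne']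
    rw [hp, hI, hρ]
    exact rootsInDisc_of_jury le_rfl (by norm_num) (by norm_num) (by norm_num) (by norm_num)
  · have hr0 : 0 < l2 / lN := div_pos h2 hN
    have hr1 : l2 / lN < 1 := (div_lt_one hN).2 h
    obtain ⟨-, hs, hd, h3, h4⟩ := piRhoOfRatio_spec hr0 hr1.le
    replace hd := hd hr1
    -- Normalized variables: `t = μ / l2`, `b = kI * μ` and `a = kp * μ`.
    have hb : piKI l2 lN * μ = (1 - piRho l2 lN) * (μ / l2) := by rw [piKI]; ring
    have hrt : l2 / lN * (μ / l2) ≤ 1 := by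
      rw [div_mul_div_cancel₀' h2.ne', div_le_one hN]; exact hμN
    have ht : 1 ≤ μ / l2 := (one_le_div h2).2 hμ
    have ha : piKp l2 lN * μ * (piRho l2 lN + l2 / lN - 1)
        = piRho l2 lN * (1 - piRho l2 lN) * (l2 / lN) ^ 2 * (μ / l2) := by
      rw [piKp, if_neg h.ne]
      have hd' : piRho l2 lN + l2 / lN - 1 ≠ 0 := hd.ne'
      generalize piRho l2 lN = ρ at hd' ⊢
      have hd'' : lN * ρ + l2 - lN ≠ 0 := by
        intro h0
        apply hd'
        field_simp
        linarith
      field_simp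
    rw [hb]
    change 0 < piRho l2 lN + l2 / lN - 1 at hd
    change piRho l2 lN < 1 at hs
    change piRho l2 lN * (1 + l2 / lN) ≤ 1 at h3
    change ∀ τ, 1 - piRho l2 lN ≤ τ → 0 ≤ (l2 / lN) ^ 2 * τ ^ 2
      - (l2 / lN) ^ 2 * (1 + piRho l2 lN) * τ + 2 * (1 + piRho l2 lN) * (piRho l2 lN + l2 / lN - 1)
      at h4
    generalize piKp l2 lN * μ = a at *
    generalize piRho l2 lN = ρ at *
    generalize l2 / lN = r at *
    generalize μ / l2 = t at *
    have hρ : 0 < ρ := by linarith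
    have ha0 : 0 ≤ a := by
      refine nonneg_of_mul_nonneg_left (b := ρ + r - 1) ?_ hd
      rw [ha]
      exact mul_nonneg (mul_nonneg (mul_nonneg hρ.le (by linarith)) (by positivity)) (by linarith)
    have hst : 1 - ρ ≤ (1 - ρ) * t := le_mul_of_one_le_right (by linarith) ht
    have j1 : 0 ≤ ρ ^ 2 - (1 + ρ - a) * ρ + (ρ - a + a * ((1 - ρ) * t)) := by
      have := mul_nonneg ha0 (sub_nonneg.2 hst)
      linarith
    have j2 : 0 ≤ ρ ^ 2 + (1 + ρ - a) * ρ + (ρ - a + a * ((1 - ρ) * t)) := by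
      refine nonneg_of_mul_nonneg_left (b := ρ + r - 1) ?_ hd
      have : (ρ ^ 2 + (1 + ρ - a) * ρ + (ρ - a + a * ((1 - ρ) * t))) * (ρ + r - 1)
          = ρ * (r ^ 2 * ((1 - ρ) * t) ^ 2 - r ^ 2 * (1 + ρ) * ((1 - ρ) * t)
            + 2 * (1 + ρ) * (ρ + r - 1)) := by
        linear_combination (-(1 + ρ) + (1 - ρ) * t) * ha
      rw [this]
      exact mul_nonneg hρ.le (h4 _ hst)
    have j3 : ρ - a + a * ((1 - ρ) * t) ≤ ρ ^ 2 := by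
      rw [← sub_nonneg]
      refine nonneg_of_mul_nonneg_left (b := ρ + r - 1) ?_ hd
      have : (ρ ^ 2 - (ρ - a + a * ((1 - ρ) * t))) * (ρ + r - 1)
          = ρ * (1 - ρ) * ((1 - r * t) * ((1 - ρ) * (1 + r * t) - r)) := by
        linear_combination (1 - (1 - ρ) * t) * ha
      rw [this]
      have hrt' : r ≤ r * t := le_mul_of_one_le_right hr0.le ht
      have : (1 - ρ) * (1 + r) ≤ (1 - ρ) * (1 + r * t) :=
        mul_le_mul_of_nonneg_left (by linarith) (by linarith)
      exact mul_nonneg (mul_nonneg hρ.le (by linarith))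
        (mul_nonneg (by linarith) (by linarith))
    refine rootsInDisc_of_jury hρ.le ?_ j3 j1 j2
    rw [abs_le]
    constructor <;> refine le_of_mul_le_mul_right ?_ hρ <;> linarith

/-! ### Parameters of the accelerated proportional-integral algorithm -/

/-- The properties of the rate `ρ` as a function of the eigenvalue ratio `r = 1 - m ^ 2`, in terms
of `S = ((1 + ρ) / (1 - ρ)) ^ 2` and of the ratio `(1 + m) ^ 2` of the two gains. The last one says
that the quadratic of the modes is nonnegative at the end of the critical interval. -/
theorem acceleratedPiRhoOfRatio_spec {r : ℝ} (h0 : 0 < r) (h1 : r ≤ 1) :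
    0 ≤ acceleratedPiRhoOfRatio r ∧ acceleratedPiRhoOfRatio r < 1 ∧
    ∃ S : ℝ, (1 + acceleratedPiRhoOfRatio r) ^ 2 = S * (1 - acceleratedPiRhoOfRatio r) ^ 2 ∧
      1 ≤ S * (1 - √(1 - r)) ∧
      ∀ t, 1 ≤ t → 0 ≤ S * (S - 1) - (1 + √(1 - r)) ^ 2 * t * S + (1 + √(1 - r)) ^ 2 * t ^ 2 := by
  have hm2 := Real.sq_sqrt (sub_nonneg.2 h1)
  have hm0 := Real.sqrt_nonneg (1 - r)
  have h22 := Real.sq_sqrt (show (0 : ℝ) ≤ 2 by norm_num)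
  have h21 : 1 < √2 := Real.lt_sqrt_of_sq_lt (by norm_num)
  have hm1 : √(1 - r) < 1 := by
    rw [Real.sqrt_lt' one_pos]; linarith
  unfold acceleratedPiRhoOfRatio
  generalize √(1 - r) = m at *
  obtain rfl : r = 1 - m ^ 2 := by linarith
  by_cases hr : 1 - m ^ 2 ≤ 2 * (√2 - 1)
  · rw [if_pos hr]
    have hDpos : 0 < 2 - 2 * m + (1 - m ^ 2) := by nlinarith
    have hD2 := Real.sq_sqrt hDpos.le
    have hD0 := Real.sqrt_pos.2 hDpos
    set D := √(2 - 2 * m + (1 - m ^ 2))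
    have hDlt : D < 2 := by nlinarith
    have hρ : (6 - 2 * m + (1 - m ^ 2) - 4 * D) / (2 + 2 * m - (1 - m ^ 2))
        = (2 - D) / (2 + D) := by
      have : 2 + 2 * m - (1 - m ^ 2) ≠ 0 := by nlinarith
      rw [div_eq_div_iff this (by positivity)]
      linear_combination -4 * hD2
    rw [hρ]
    refine ⟨div_nonneg (by linarith) (by linarith), ?_, 4 / D ^ 2, ?_, ?_, fun t _ => ?_⟩
    · rw [div_lt_one (by linarith)]; linarith
    · field_simp; ring
    · rw [div_mul_eq_mul_div, one_le_div (by positivity), hD2]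
      nlinarith
    · have hk : (1 + m) ^ 2 = 4 - D ^ 2 := by linear_combination hD2
      have : 4 / D ^ 2 * (4 / D ^ 2 - 1) - (1 + m) ^ 2 * t * (4 / D ^ 2) + (1 + m) ^ 2 * t ^ 2
          = (1 + m) ^ 2 * (t - 2 / D ^ 2) ^ 2 := by
        rw [hk]; field_simp; ring
      rw [this]
      positivity
  · rw [if_neg hr]
    have hm : m < √2 - 1 := abs_lt_of_sq_lt_sq (by nlinarith) (by linarith) |> (abs_lt.1 · |>.2)
    have hρ : (if 1 - m ^ 2 = 1 then 0
        else (-3 - 2 * m + (1 - m ^ 2) + 2 * √(2 + 2 * m - (1 - m ^ 2)))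
          / (-1 - 2 * m + (1 - m ^ 2))) = m / (2 + m) := by
      have hsq : √(2 + 2 * m - (1 - m ^ 2)) = 1 + m := by
        rw [show 2 + 2 * m - (1 - m ^ 2) = (1 + m) ^ 2 by ring, Real.sqrt_sq (by linarith)]
      split_ifs with h
      · have : m = 0 := by simpa using h
        simp [this]
      · have hm' : 0 < m := hm0.lt_of_ne fun h' => h (by rw [← h']; ring)
        rw [hsq, div_eq_div_iff (by nlinarith) (by linarith)]
        ring
    rw [hρ]
    refine ⟨by positivity, ?_, (1 + m) ^ 2, ?_, ?_, fun t ht => ?_⟩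
    · rw [div_lt_one (by linarith)]; linarith
    · field_simp; ring
    · nlinarith [mul_nonneg hm0 (show 0 ≤ 1 - m - m ^ 2 by nlinarith)]
    · have : (1 + m) ^ 2 * ((1 + m) ^ 2 - 1) - (1 + m) ^ 2 * t * (1 + m) ^ 2
          + (1 + m) ^ 2 * t ^ 2 = (1 + m) ^ 2 * ((t - 1) * (t - ((1 + m) ^ 2 - 1))) := by ring
      rw [this]
      exact mul_nonneg (sq_nonneg _) (mul_nonneg (by linarith) (by nlinarith))

/-- The substitution `w = z + ρ ^ 2 / z` turns the quartic characteristic polynomial of a mode into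
a quadratic in `w`; its roots are real and lie in `[-2 * ρ, 2 * ρ]`, so that all `z` have modulus
`ρ`. -/
theorem acceleratedPi_roots {l2 lN μ : ℝ} (h2 : 0 < l2) (hμ : l2 ≤ μ) (hμN : μ ≤ lN) :
    ∃ w₁ w₂ : ℝ, w₁ + w₂ = (1 + acceleratedPiRho l2 lN) ^ 2 - acceleratedPiKp l2 lN * μ ∧
      w₁ * w₂ = 2 * acceleratedPiRho l2 lN * (1 + acceleratedPiRho l2 lN ^ 2)
        - acceleratedPiKp l2 lN * μ * (1 + acceleratedPiRho l2 lN ^ 2)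
        + acceleratedPiKp l2 lN * μ * (acceleratedPiKI l2 lN * μ) ∧
      |w₁| ≤ 2 * acceleratedPiRho l2 lN ∧ |w₂| ≤ 2 * acceleratedPiRho l2 lN := by
  have hN : 0 < lN := by linarith
  have hr0 : 0 < l2 / lN := div_pos h2 hN
  have hr1 : l2 / lN ≤ 1 := (div_le_one hN).2 (hμ.trans hμN)
  obtain ⟨hρ0, hρ1, S, hS, hSm, hq⟩ := acceleratedPiRhoOfRatio_spec hr0 hr1
  change 0 ≤ acceleratedPiRho l2 lN at hρ0
  change acceleratedPiRho l2 lN < 1 at hρ1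
  change (1 + acceleratedPiRho l2 lN) ^ 2 = S * (1 - acceleratedPiRho l2 lN) ^ 2 at hS
  have hb : acceleratedPiKI l2 lN * μ = (1 - acceleratedPiRho l2 lN) ^ 2 * (μ / l2) := by
    rw [acceleratedPiKI]; ring
  have hm2 := Real.sq_sqrt (sub_nonneg.2 hr1)
  have ha : acceleratedPiKp l2 lN * μ
      = (1 + √(1 - l2 / lN)) ^ 2 * ((1 - acceleratedPiRho l2 lN) ^ 2 * (μ / l2)) := by
    rw [acceleratedPiKp, mul_assoc, hb]
    congr 1
    linear_combination -hm2
  have hrt : l2 / lN * (μ / l2) ≤ 1 := by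
    rw [div_mul_div_cancel₀' h2.ne', div_le_one hN]; exact hμN
  have ht : 1 ≤ μ / l2 := (one_le_div h2).2 hμ
  have hm0 := Real.sqrt_nonneg (1 - l2 / lN)
  rw [ha, hb]
  generalize acceleratedPiRho l2 lN = ρ at *
  generalize √(1 - l2 / lN) = m at *
  generalize μ / l2 = t at *
  obtain ⟨r, hr⟩ : ∃ r, l2 / lN = r := ⟨_, rfl⟩
  rw [hr] at hm2 hrt hr0 hr1
  obtain rfl : r = 1 - m ^ 2 := by linarith
  have hm1 : m < 1 := by nlinarith
  obtain ⟨s, hs⟩ : ∃ s, s = (1 - ρ) ^ 2 := ⟨_, rfl⟩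
  have hs0 : 0 ≤ s := hs ▸ sq_nonneg _
  have h4ρ : 4 * ρ = (S - 1) * s := by rw [hs]; linear_combination hS
  rw [← hs] at hS ⊢
  have hkt : (1 + m) ^ 2 * t ≤ 2 * S - 1 := by
    -- `(1 - m) * t ≤ 1 / (1 + m)` and `S ≥ 1 / (1 - m)`
    refine le_of_mul_le_mul_right ?_ (sub_pos.2 hm1)
    nlinarith [mul_le_mul_of_nonneg_left hrt (show 0 ≤ 1 + m by linarith)]
  have hkt1 : 1 ≤ (1 + m) ^ 2 * t := by nlinarith
  refine exists_real_roots ?_ ?_ ?_ ?_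
  · have : ((1 + ρ) ^ 2 - (1 + m) ^ 2 * (s * t)) ^ 2 - 4 * (2 * ρ * (1 + ρ ^ 2)
        - (1 + m) ^ 2 * (s * t) * (1 + ρ ^ 2) + (1 + m) ^ 2 * (s * t) * (s * t))
        = s ^ 2 * ((1 - (1 - m ^ 2) * t) * (1 + (1 + m) ^ 2 * t + 2 * (1 + m) * t)) := by
      rw [hs]; ring
    rw [this]
    exact mul_nonneg (sq_nonneg s) (mul_nonneg (by linarith) (by positivity))
  · rw [abs_le]
    have e1 := mul_le_mul_of_nonneg_left hkt hs0
    have e2 := mul_le_mul_of_nonneg_left hkt1 hs0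
    constructor <;> linarith
  · have : (2 * ρ) ^ 2 - ((1 + ρ) ^ 2 - (1 + m) ^ 2 * (s * t)) * (2 * ρ)
        + (2 * ρ * (1 + ρ ^ 2) - (1 + m) ^ 2 * (s * t) * (1 + ρ ^ 2)
          + (1 + m) ^ 2 * (s * t) * (s * t)) = s ^ 2 * ((1 + m) ^ 2 * t * (t - 1)) := by
      rw [hs]; ring
    rw [this]
    exact mul_nonneg (sq_nonneg s) (mul_nonneg (by positivity) (by linarith))
  · have : (2 * ρ) ^ 2 + ((1 + ρ) ^ 2 - (1 + m) ^ 2 * (s * t)) * (2 * ρ)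
        + (2 * ρ * (1 + ρ ^ 2) - (1 + m) ^ 2 * (s * t) * (1 + ρ ^ 2)
          + (1 + m) ^ 2 * (s * t) * (s * t))
        = s ^ 2 * (S * (S - 1) - (1 + m) ^ 2 * t * S + (1 + m) ^ 2 * t ^ 2) := by
      have e : (2 * ρ) ^ 2 + ((1 + ρ) ^ 2 - (1 + m) ^ 2 * (s * t)) * (2 * ρ)
        + (2 * ρ * (1 + ρ ^ 2) - (1 + m) ^ 2 * (s * t) * (1 + ρ ^ 2)
          + (1 + m) ^ 2 * (s * t) * (s * t)) = 4 * ρ * (1 + ρ) ^ 2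
          - (1 + m) ^ 2 * s * t * (1 + ρ) ^ 2 + (1 + m) ^ 2 * (s * t) ^ 2 := by ring
      rw [e, hS, h4ρ]
      ring
    rw [this]
    exact mul_nonneg (sq_nonneg s) (hq t ht)

/-! ### Modes of the four algorithms -/

/-- The scalar recursion of a mode of the accelerated proportional-integral algorithm, where `y`
is the disagreement mode and `P` the integrator mode. Eliminating `P` gives a fourth-order
recursion, which splits into two second-order ones with constant term `ρ ^ 2`. -/
theorem acceleratedPi_mode_rate {ρ a b w₁ w₂ U : ℝ} {y P : ℕ → ℝ}
    (hs : w₁ + w₂ = (1 + ρ) ^ 2 - a)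
    (hp : w₁ * w₂ = 2 * ρ * (1 + ρ ^ 2) - a * (1 + ρ ^ 2) + a * b)
    (h₁ : |w₁| ≤ 2 * ρ) (h₂ : |w₂| ≤ 2 * ρ)
    (hy : ∀ k, y (k + 2) = 2 * ρ * y (k + 1) - ρ ^ 2 * y k + (1 - ρ) ^ 2 * U
      - a * (y (k + 1) + P (k + 1)))
    (hP : ∀ k, P (k + 2) = (1 + ρ ^ 2) * P (k + 1) - ρ ^ 2 * P k + b * y (k + 1)) :
    HasRate ρ y := by
  have hg : HasRate ρ (fun k => y (k + 2) - (w₁ * y (k + 1) - ρ ^ 2 * y k)) := by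
    refine HasRate.of_second_order (rootsInDisc_of_abs_le h₂) HasRate.zero fun k => ?_
    have A0 := hy k
    have A1 := hy (k + 1)
    have A2 := hy (k + 2)
    have B1 := hP (k + 1)
    linear_combination A2 - (1 + ρ ^ 2) * A1 + ρ ^ 2 * A0 - a * B1
      - (y (k + 3) + ρ ^ 2 * y (k + 1)) * hs + y (k + 2) * hp
  exact HasRate.of_second_order (rootsInDisc_of_abs_le h₁) hg fun k => by ring

namespace WeightedGraph

open Matrix

variable {N : ℕ} (G : WeightedGraph N) {l2 lN : ℝ} {u : Fin N → ℝ}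

theorem plain_converges (hG : G.Connected) (hl2 : IsLeast G.nonzeroEigenvalues l2)
    (hlN : IsGreatest G.nonzeroEigenvalues lN) :
    ConvergesExpWithRate (G.plainOutputs (plainKI l2 lN) (fun _ => u)) (average u)
      (plainRho l2 lN) := by
  have h2 := G.pos_of_mem_nonzeroEigenvalues hl2.1
  have h2N := hlN.2 hl2.1
  refine G.convergesExpWithRate_of_modes hG (plainRho_nonneg h2 h2N) (plainRho_lt_one h2 h2N)
    ?_ ?_ fun _ => ?_
  · rintro x ⟨p, hp0, hp⟩
    have hx : ∀ k, x k = u - p k := fun k => funext fun i => (hp k i).2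
    have hp' : ∀ k, p (k + 1) = p k + plainKI l2 lN • G.laplacian *ᵥ x k := fun k =>
      funext fun i => by rw [(hp k i).1, sum_eq_laplacian_mulVec]; rfl
    have hsum : ∀ k, 1 ⬝ᵥ p k = 0 := by
      intro k
      induction k with
      | zero => simpa [dotProduct] using hp0
      | succ k ih =>
        rw [hp', dotProduct_add, ih, dotProduct_smul,
          G.dotProduct_laplacian_mulVec (μ := 0) (by simp [laplacian_mulVec_one])]
        simp
    have : ∀ k, 1 ⬝ᵥ x k - 1 ⬝ᵥ u = 0 := fun k => by
      rw [hx, dotProduct_sub, hsum]; ring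
    simpa only [this] using HasRate.zero
  · rintro x ⟨p, -, hp⟩ v μ hμ hv
    have hx : ∀ k, x k = u - p k := fun k => funext fun i => (hp k i).2
    have hp' : ∀ k, p (k + 1) = p k + plainKI l2 lN • G.laplacian *ᵥ x k := fun k =>
      funext fun i => by rw [(hp k i).1, sum_eq_laplacian_mulVec]; rfl
    have hrec : ∀ k, v ⬝ᵥ x (k + 1) = (1 - plainKI l2 lN * μ) * v ⬝ᵥ x k := fun k => by
      have e : v ⬝ᵥ x k = v ⬝ᵥ u - v ⬝ᵥ p k := by rw [hx, dotProduct_sub]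
      rw [hx (k + 1), hp', dotProduct_sub, dotProduct_add, dotProduct_smul,
        G.dotProduct_laplacian_mulVec hv, smul_eq_mul]
      linear_combination -e
    have hm := plain_multiplier h2 (hl2.2 hμ) (hlN.2 hμ)
    have h1 : HasRate (plainRho l2 lN) (fun k => ((v ⬝ᵥ x k : ℝ) : ℂ)) := by
      refine HasRate.of_first_order (α := ((1 - plainKI l2 lN * μ : ℝ) : ℂ)) (g := fun _ => 0) ?_
        (fun r _ => ⟨0, fun _ => by simp⟩) fun k => ?_
      · rwa [Complex.norm_real]
      · rw [hrec]; push_cast; ring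
    exact fun r hr => by simpa using h1 r hr
  · obtain ⟨hne, v, hv0, hv⟩ := G.mem_nonzeroEigenvalues_iff.1 hl2.1
    have hv1 := G.dotProduct_one_eq_zero hv hne
    have hvv := dotProduct_self_pos_of_ne_zero hv0
    -- Start with `v`-component `1`.
    let p : ℕ → Fin N → ℝ := fun k => Nat.rec (((v ⬝ᵥ u - 1) / (v ⬝ᵥ v)) • v)
      (fun _ p => p + plainKI l2 lN • G.laplacian *ᵥ (u - p)) k
    refine ⟨fun k => u - p k, ⟨p, ?_, fun k i => ⟨?_, rfl⟩⟩, v, 1, one_ne_zero, fun k => ?_⟩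
    · have : 1 ⬝ᵥ p 0 = 0 := by
        change 1 ⬝ᵥ (((v ⬝ᵥ u - 1) / (v ⬝ᵥ v)) • v) = 0
        rw [dotProduct_smul, dotProduct_comm 1 v, hv1, smul_zero]
      simpa [dotProduct] using this
    · rw [sum_eq_laplacian_mulVec]; rfl
    · have hc : v ⬝ᵥ (fun _ => average u) = 0 := by
        have : (fun _ => average u) = average u • (1 : Fin N → ℝ) := by ext; simp
        rw [this, dotProduct_smul, hv1, smul_zero]
      rw [hc, sub_zero, one_mul]
      induction k with
      | zero =>
        change v ⬝ᵥ (u - ((v ⬝ᵥ u - 1) / (v ⬝ᵥ v)) • v) = _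
        rw [dotProduct_sub, dotProduct_smul, smul_eq_mul, div_mul_cancel₀ _ hvv.ne']
        simp
      | succ k ih =>
        change v ⬝ᵥ (u - (p k + plainKI l2 lN • G.laplacian *ᵥ (u - p k))) = _
        rw [← sub_sub, dotProduct_sub v, dotProduct_smul, G.dotProduct_laplacian_mulVec hv, ih,
          smul_eq_mul, pow_succ, ← plain_multiplier_left h2 h2N]
        ring

theorem accelerated_converges (hG : G.Connected) (hl2 : IsLeast G.nonzeroEigenvalues l2)
    (hlN : IsGreatest G.nonzeroEigenvalues lN) :
    ConvergesExpWithRate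
      (G.acceleratedOutputs (acceleratedRho l2 lN) (acceleratedKI l2 lN) (fun _ => u))
      (average u) (acceleratedRho l2 lN) := by
  have h2 := G.pos_of_mem_nonzeroEigenvalues hl2.1
  have h2N := hlN.2 hl2.1
  have hdisc := fun (μ : ℝ) => accelerated_rootsInDisc (lN := lN) h2 (μ := μ)
  have hleft := acceleratedKI_mul_left (lN := lN) h2
  have hρ0 := acceleratedRho_nonneg h2N
  have hρ1 := acceleratedRho_lt_one (lN := lN) h2
  generalize acceleratedRho l2 lN = ρ at *
  generalize acceleratedKI l2 lN = kI at *
  refine G.convergesExpWithRate_of_modes hG hρ0 hρ1 ?_ ?_ fun hρ => ?_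
  · rintro x ⟨p, hp0, hp1, hp⟩
    have hx : ∀ k, x k = u - p k := fun k => funext fun i => (hp k i).2
    have hp' : ∀ k : ℕ, p (k + 1) = (1 + ρ ^ 2) • p k - ρ ^ 2 • p (k - 1)
        + kI • G.laplacian *ᵥ x k := fun k =>
      funext fun i => by rw [(hp k i).1, sum_eq_laplacian_mulVec]; rfl
    have hsum : ∀ k : ℕ, 1 ⬝ᵥ p (k - 1) = 0 ∧ 1 ⬝ᵥ p k = 0 := by
      intro k
      induction k with
      | zero => exact ⟨by simpa [dotProduct] using hp1, by simpa [dotProduct] using hp0⟩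
      | succ k ih =>
        push_cast
        rw [add_sub_cancel_right]
        refine ⟨ih.2, ?_⟩
        rw [hp', dotProduct_add, dotProduct_sub, dotProduct_smul, dotProduct_smul,
          dotProduct_smul, ih.1, ih.2,
          G.dotProduct_laplacian_mulVec (μ := 0) (by simp [laplacian_mulVec_one])]
        simp
    have : ∀ k, 1 ⬝ᵥ x k - 1 ⬝ᵥ u = 0 := fun k => by
      rw [hx, dotProduct_sub, (hsum k).2]; ring
    simpa only [this] using HasRate.zero
  · rintro x ⟨p, -, -, hp⟩ v μ hμ hv
    have hx : ∀ k, x k = u - p k := fun k => funext fun i => (hp k i).2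
    have hp' : ∀ k : ℕ, p (k + 1) = (1 + ρ ^ 2) • p k - ρ ^ 2 • p (k - 1)
        + kI • G.laplacian *ᵥ x k := fun k =>
      funext fun i => by rw [(hp k i).1, sum_eq_laplacian_mulVec]; rfl
    -- Shifting the time by one makes the initial state at time `-1` part of the sequence.
    have h : HasRate ρ (fun k : ℕ => v ⬝ᵥ u - v ⬝ᵥ p (k - 1)) := by
      refine HasRate.of_second_order (hdisc μ (hl2.2 hμ) (hlN.2 hμ)) HasRate.zero fun k => ?_
      have e2 : ((k + 2 : ℕ) : ℤ) - 1 = k + 1 := by push_cast; ring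
      have e1 : ((k + 1 : ℕ) : ℤ) - 1 = k := by push_cast; ring
      rw [e2, e1, hp', dotProduct_add, dotProduct_sub, dotProduct_smul, dotProduct_smul,
        dotProduct_smul, G.dotProduct_laplacian_mulVec hv, hx, dotProduct_sub]
      simp only [smul_eq_mul]
      ring
    refine fun r hr => ?_
    simpa [hx, dotProduct_sub] using h.shift r hr
  · obtain ⟨hne, v, hv0, hv⟩ := G.mem_nonzeroEigenvalues_iff.1 hl2.1
    have hv1 := G.dotProduct_one_eq_zero hv hne
    have hvv := dotProduct_self_pos_of_ne_zero hv0
    -- Start with `v`-components `1` and `ρ` at the times `-1` and `0`.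
    obtain ⟨p, hpm, hp0, hp⟩ := exists_int_recursion
      (fun q q' : Fin N → ℝ => (1 + ρ ^ 2) • q - ρ ^ 2 • q' + kI • G.laplacian *ᵥ (u - q))
      (((v ⬝ᵥ u - 1) / (v ⬝ᵥ v)) • v) (((v ⬝ᵥ u - ρ) / (v ⬝ᵥ v)) • v)
    have hcomp : ∀ c : ℝ, v ⬝ᵥ u - v ⬝ᵥ (((v ⬝ᵥ u - c) / (v ⬝ᵥ v)) • v) = c := fun c => by
      rw [dotProduct_smul, smul_eq_mul, div_mul_cancel₀ _ hvv.ne']; ring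
    have hmean : ∀ c : ℝ, ∑ i, (c • v) i = 0 := fun c => by
      have : 1 ⬝ᵥ (c • v) = 0 := by rw [dotProduct_smul, dotProduct_comm, hv1, smul_zero]
      simpa [dotProduct] using this
    refine ⟨fun k => u - p k, ⟨p, ?_, ?_, fun k i => ⟨?_, rfl⟩⟩, v, ρ, hρ.ne', fun k => ?_⟩
    · rw [hp0]; exact hmean _
    · rw [hpm]; exact hmean _
    · rw [sum_eq_laplacian_mulVec, hp]; rfl
    · have hc : v ⬝ᵥ (fun _ => average u) = 0 := by
        have : (fun _ => average u) = average u • (1 : Fin N → ℝ) := by ext; simp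
        rw [this, dotProduct_smul, hv1, smul_zero]
      have key : ∀ k : ℕ, v ⬝ᵥ u - v ⬝ᵥ p (k - 1) = ρ ^ k ∧ v ⬝ᵥ u - v ⬝ᵥ p k = ρ ^ (k + 1) := by
        intro k
        induction k with
        | zero =>
          refine ⟨?_, ?_⟩
          · simpa [hpm] using hcomp 1
          · simpa [hp0] using hcomp ρ
        | succ k ih =>
          push_cast
          rw [add_sub_cancel_right]
          refine ⟨ih.2, ?_⟩
          rw [hp, dotProduct_add, dotProduct_sub, dotProduct_smul, dotProduct_smul,
            dotProduct_smul, G.dotProduct_laplacian_mulVec hv, dotProduct_sub]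
          simp only [smul_eq_mul]
          linear_combination (1 + ρ ^ 2) * ih.2 - ρ ^ 2 * ih.1
            - (v ⬝ᵥ u - v ⬝ᵥ p k) * hleft - (1 - ρ) ^ 2 * ih.2
      rw [hc, sub_zero, dotProduct_sub, (key k).2]
      ring

theorem pi_converges (hG : G.Connected) (hl2 : IsLeast G.nonzeroEigenvalues l2)
    (hlN : IsGreatest G.nonzeroEigenvalues lN) :
    ConvergesExpWithRate
      (G.piOutputs (piRho l2 lN) (piKI l2 lN) (piKp l2 lN) (fun _ => u))
      (average u) (piRho l2 lN) := by
  have h2 := G.pos_of_mem_nonzeroEigenvalues hl2.1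
  have h2N := hlN.2 hl2.1
  have hN := h2.trans_le h2N
  have hdisc := fun (μ : ℝ) => pi_rootsInDisc (lN := lN) h2 (μ := μ)
  obtain ⟨hρ0, hρ1, -⟩ := piRhoOfRatio_spec (div_pos h2 hN) ((div_le_one hN).2 h2N)
  change 0 ≤ piRho l2 lN at hρ0
  change piRho l2 lN < 1 at hρ1
  generalize piRho l2 lN = ρ at *
  generalize piKI l2 lN = kI at *
  generalize piKp l2 lN = kp at *
  have h1 : G.laplacian *ᵥ 1 = (0 : ℝ) • (1 : Fin N → ℝ) := by simp [laplacian_mulVec_one]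
  -- The mean of the state `q` is multiplied by `ρ` in each step.
  have hmean : ∀ (x p q : ℕ → Fin N → ℝ), (∀ k, q (k + 1) = ρ • q k
      + kp • G.laplacian *ᵥ (x k + p k)) → ∀ k, 1 ⬝ᵥ q k = 1 ⬝ᵥ q 0 * ρ ^ k := by
    intro x p q hq k
    induction k with
    | zero => simp
    | succ k ih =>
      rw [hq, dotProduct_add, dotProduct_smul, dotProduct_smul,
        G.dotProduct_laplacian_mulVec h1, ih]
      simp only [smul_eq_mul]
      ring
  have hvec : ∀ x ∈ G.piOutputs ρ kI kp (fun _ => u), ∃ p q : ℕ → Fin N → ℝ,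
      (∀ k, q (k + 1) = ρ • q k + kp • G.laplacian *ᵥ (x k + p k)) ∧
      (∀ k, p (k + 1) = p k + kI • G.laplacian *ᵥ x k) ∧ ∀ k, x k = u - q k := by
    rintro x ⟨p, q, h⟩
    refine ⟨p, q, fun k => funext fun i => ?_, fun k => funext fun i => ?_,
      fun k => funext fun i => (h k i).2.2⟩
    · rw [(h k i).1]
      simp only [← add_sub_add_comm]
      rw [G.sum_eq_laplacian_mulVec (fun i => x k i + p k i)]
      rfl
    · rw [(h k i).2.1, sum_eq_laplacian_mulVec]; rfl
  refine G.convergesExpWithRate_of_modes hG hρ0 hρ1 ?_ ?_ fun hρ => ?_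
  · intro x hx
    obtain ⟨p, q, hq, -, hx⟩ := hvec x hx
    intro r hr
    refine ⟨|1 ⬝ᵥ q 0|, fun k => ?_⟩
    beta_reduce
    rw [hx, dotProduct_sub, hmean x p q hq, sub_sub_cancel_left, norm_neg, norm_mul,
      Real.norm_eq_abs, norm_pow, Real.norm_eq_abs, abs_of_nonneg hρ0]
    gcongr
  · intro x hx v μ hμ hv
    obtain ⟨p, q, hq, hp, hx⟩ := hvec x hx
    have hq' : ∀ k, v ⬝ᵥ x (k + 1) = (1 - ρ) * v ⬝ᵥ u + ρ * v ⬝ᵥ x k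
        - kp * μ * (v ⬝ᵥ x k + v ⬝ᵥ p k) := fun k => by
      have e : v ⬝ᵥ x k = v ⬝ᵥ u - v ⬝ᵥ q k := by rw [hx, dotProduct_sub]
      have e1 : v ⬝ᵥ q (k + 1) = ρ * v ⬝ᵥ q k + kp * (μ * (v ⬝ᵥ x k + v ⬝ᵥ p k)) := by
        rw [hq, dotProduct_add, dotProduct_smul, dotProduct_smul,
          G.dotProduct_laplacian_mulVec hv, dotProduct_add]
        rfl
      rw [hx (k + 1), dotProduct_sub, e1]
      linear_combination -ρ * e
    have hp' : ∀ k, v ⬝ᵥ p (k + 1) = v ⬝ᵥ p k + kI * (μ * v ⬝ᵥ x k) := fun k => by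
      rw [hp, dotProduct_add, dotProduct_smul, G.dotProduct_laplacian_mulVec hv]; rfl
    refine HasRate.of_second_order (hdisc μ (hl2.2 hμ) (hlN.2 hμ)) HasRate.zero fun k => ?_
    linear_combination hq' (k + 1) - hq' k - kp * μ * hp' k
  · -- Start with `q = 1`, so that the mean mode is excited.
    let s : ℕ → (Fin N → ℝ) × (Fin N → ℝ) := fun k => Nat.rec (0, 1)
      (fun _ s => (s.1 + kI • G.laplacian *ᵥ (u - s.2),
        ρ • s.2 + kp • G.laplacian *ᵥ ((u - s.2) + s.1))) k
    have hNne : (N : ℝ) ≠ 0 := by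
      obtain ⟨i⟩ := hG.nonempty
      exact_mod_cast (Fin.pos i).ne'
    refine ⟨fun k => u - (s k).2, ⟨fun k => (s k).1, fun k => (s k).2, fun k i => ⟨?_, ?_, rfl⟩⟩,
      1, -N, neg_ne_zero.2 hNne, fun k => ?_⟩
    · simp only [← add_sub_add_comm]
      rw [G.sum_eq_laplacian_mulVec (fun i => (u - (s k).2) i + (s k).1 i)]
      rfl
    · rw [G.sum_eq_laplacian_mulVec (u - (s k).2)]; rfl
    · have h := hmean (fun k => u - (s k).2) (fun k => (s k).1) (fun k => (s k).2) (fun _ => rfl) k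
      have h0 : 1 ⬝ᵥ (s 0).2 = (N : ℝ) := by
        change 1 ⬝ᵥ (1 : Fin N → ℝ) = N
        simp
      have hu : 1 ⬝ᵥ (fun _ : Fin N => average u) = 1 ⬝ᵥ u := by
        simp [dotProduct, average, mul_div_cancel₀ _ hNne]
      rw [dotProduct_sub, h, h0, hu]
      ring

theorem acceleratedPi_converges (hG : G.Connected) (hl2 : IsLeast G.nonzeroEigenvalues l2)
    (hlN : IsGreatest G.nonzeroEigenvalues lN) :
    ConvergesExpWithRate
      (G.acceleratedPiOutputs (acceleratedPiRho l2 lN) (acceleratedPiKI l2 lN)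
        (acceleratedPiKp l2 lN) (fun _ => u))
      (average u) (acceleratedPiRho l2 lN) := by
  have h2 := G.pos_of_mem_nonzeroEigenvalues hl2.1
  have h2N := hlN.2 hl2.1
  have hN := h2.trans_le h2N
  have hroots := fun (μ : ℝ) => acceleratedPi_roots (lN := lN) h2 (μ := μ)
  obtain ⟨hρ0, hρ1, -⟩ := acceleratedPiRhoOfRatio_spec (div_pos h2 hN) ((div_le_one hN).2 h2N)
  change 0 ≤ acceleratedPiRho l2 lN at hρ0
  change acceleratedPiRho l2 lN < 1 at hρ1
  generalize acceleratedPiRho l2 lN = ρ at *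
  generalize acceleratedPiKI l2 lN = kI at *
  generalize acceleratedPiKp l2 lN = kp at *
  have h1 : G.laplacian *ᵥ 1 = (0 : ℝ) • (1 : Fin N → ℝ) := by simp [laplacian_mulVec_one]
  -- The mean of the state `q` follows a recursion with the double characteristic root `ρ`.
  have hmean : ∀ (x : ℕ → Fin N → ℝ) (p q : ℤ → Fin N → ℝ), (∀ k : ℕ, q (k + 1) = (2 * ρ) • q k
      - ρ ^ 2 • q (k - 1) + kp • G.laplacian *ᵥ (x k + p k)) →
      ∀ k : ℕ, 1 ⬝ᵥ q (k + 1) = 2 * ρ * 1 ⬝ᵥ q k - ρ ^ 2 * 1 ⬝ᵥ q (k - 1) := by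
    intro x p q hq k
    rw [hq, dotProduct_add, dotProduct_sub, dotProduct_smul, dotProduct_smul, dotProduct_smul,
      G.dotProduct_laplacian_mulVec h1]
    simp only [smul_eq_mul]
    ring
  have hvec : ∀ x ∈ G.acceleratedPiOutputs ρ kI kp (fun _ => u), ∃ p q : ℤ → Fin N → ℝ,
      (∀ k : ℕ, q (k + 1) = (2 * ρ) • q k - ρ ^ 2 • q (k - 1)
        + kp • G.laplacian *ᵥ (x k + p k)) ∧
      (∀ k : ℕ, p (k + 1) = (1 + ρ ^ 2) • p k - ρ ^ 2 • p (k - 1)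
        + kI • G.laplacian *ᵥ x k) ∧ ∀ k : ℕ, x k = u - q k := by
    rintro x ⟨p, q, h⟩
    refine ⟨p, q, fun k => funext fun i => ?_, fun k => funext fun i => ?_,
      fun k => funext fun i => (h k i).2.2⟩
    · rw [(h k i).1]
      simp only [← add_sub_add_comm]
      rw [G.sum_eq_laplacian_mulVec (fun i => x k i + p k i)]
      rfl
    · rw [(h k i).2.1, sum_eq_laplacian_mulVec]; rfl
  refine G.convergesExpWithRate_of_modes hG hρ0 hρ1 ?_ ?_ fun hρ => ?_
  · intro x hx
    obtain ⟨p, q, hq, -, hx⟩ := hvec x hx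
    have h : HasRate ρ (fun k : ℕ => -(1 ⬝ᵥ q (k - 1))) := by
      refine HasRate.of_second_order (rootsInDisc_of_abs_le (w := 2 * ρ) ?_) HasRate.zero
        fun k => ?_
      · rw [abs_of_nonneg (by positivity)]
      · have e2 : ((k + 2 : ℕ) : ℤ) - 1 = k + 1 := by push_cast; ring
        have e1 : ((k + 1 : ℕ) : ℤ) - 1 = k := by push_cast; ring
        rw [e2, e1, hmean x p q hq]
        ring
    refine fun r hr => ?_
    simpa [hx, dotProduct_sub] using h.shift r hr
  · intro x hx v μ hμ hv
    obtain ⟨p, q, hq, hp, hx⟩ := hvec x hx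
    obtain ⟨w₁, w₂, hs, hpr, hw₁, hw₂⟩ := hroots μ (hl2.2 hμ) (hlN.2 hμ)
    -- Shifting the time by one makes the initial state at time `-1` part of the sequence.
    have h : HasRate ρ (fun k : ℕ => v ⬝ᵥ u - v ⬝ᵥ q (k - 1)) := by
      refine acceleratedPi_mode_rate (U := v ⬝ᵥ u) (P := fun k : ℕ => v ⬝ᵥ p (k - 1)) hs hpr hw₁ hw₂
        (fun k => ?_) fun k => ?_
      all_goals
        have e2 : ((k + 2 : ℕ) : ℤ) - 1 = k + 1 := by push_cast; ring
        have e1 : ((k + 1 : ℕ) : ℤ) - 1 = k := by push_cast; ring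
        simp only [e2, e1]
      · rw [hq, dotProduct_add, dotProduct_sub, dotProduct_smul, dotProduct_smul,
          dotProduct_smul, G.dotProduct_laplacian_mulVec hv, dotProduct_add, hx, dotProduct_sub]
        simp only [smul_eq_mul]
        ring
      · rw [hp, dotProduct_add, dotProduct_sub, dotProduct_smul, dotProduct_smul,
          dotProduct_smul, G.dotProduct_laplacian_mulVec hv, hx, dotProduct_sub]
        simp only [smul_eq_mul]
        ring
    refine fun r hr => ?_
    simpa [hx, dotProduct_sub] using h.shift r hr
  · -- Start with `q = 1` and `q = ρ` at the times `-1` and `0`, so that the mean mode is geometric.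
    obtain ⟨s, hsm, hs0, hs⟩ := exists_int_recursion
      (fun s s' : (Fin N → ℝ) × (Fin N → ℝ) =>
        ((1 + ρ ^ 2) • s.1 - ρ ^ 2 • s'.1 + kI • G.laplacian *ᵥ (u - s.2),
          (2 * ρ) • s.2 - ρ ^ 2 • s'.2 + kp • G.laplacian *ᵥ ((u - s.2) + s.1)))
      (0, 1) (0, ρ • 1)
    have hNne : (N : ℝ) ≠ 0 := by
      obtain ⟨i⟩ := hG.nonempty
      exact_mod_cast (Fin.pos i).ne'
    refine ⟨fun k => u - (s k).2, ⟨fun k => (s k).1, fun k => (s k).2, fun k i => ⟨?_, ?_, rfl⟩⟩,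
      1, -(N * ρ), neg_ne_zero.2 (mul_ne_zero hNne hρ.ne'), fun k => ?_⟩
    · beta_reduce
      simp only [← add_sub_add_comm]
      rw [G.sum_eq_laplacian_mulVec (fun i => (u - (s k).2) i + (s k).1 i), hs]
      rfl
    · beta_reduce
      rw [G.sum_eq_laplacian_mulVec (u - (s k).2), hs]; rfl
    · have h := hmean (fun k => u - (s k).2) (fun k => (s k).1) (fun k => (s k).2)
        (fun k => by rw [hs])
      have key : ∀ k : ℕ, 1 ⬝ᵥ (s (k - 1)).2 = N * ρ ^ k ∧ 1 ⬝ᵥ (s k).2 = N * ρ ^ (k + 1) := by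
        intro k
        induction k with
        | zero =>
          refine ⟨?_, ?_⟩
          · simp [hsm]
          · simp [hs0, mul_comm]
        | succ k ih =>
          push_cast
          rw [add_sub_cancel_right]
          refine ⟨ih.2, ?_⟩
          rw [h, ih.1, ih.2]
          ring
      have hu : 1 ⬝ᵥ (fun _ : Fin N => average u) = 1 ⬝ᵥ u := by
        simp [dotProduct, average, mul_div_cancel₀ _ hNne]
      rw [dotProduct_sub, (key k).2, hu]
      ring

end WeightedGraph

end ConsensusDT

theorem mainTheorem3 {N : ℕ} (G : ConsensusDT.WeightedGraph N) (hG : G.Connected)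
    (l2 lN : ℝ) (hl2 : IsLeast G.nonzeroEigenvalues l2)
    (hlN : IsGreatest G.nonzeroEigenvalues lN) (u : Fin N → ℝ) :
    ConsensusDT.ConvergesExpWithRate
      (G.plainOutputs (ConsensusDT.plainKI l2 lN) (fun _ => u))
      (ConsensusDT.average u) (ConsensusDT.plainRho l2 lN) ∧
    ConsensusDT.ConvergesExpWithRate
      (G.acceleratedOutputs (ConsensusDT.acceleratedRho l2 lN)
        (ConsensusDT.acceleratedKI l2 lN) (fun _ => u))
      (ConsensusDT.average u) (ConsensusDT.acceleratedRho l2 lN) ∧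
    ConsensusDT.ConvergesExpWithRate
      (G.piOutputs (ConsensusDT.piRho l2 lN) (ConsensusDT.piKI l2 lN)
        (ConsensusDT.piKp l2 lN) (fun _ => u))
      (ConsensusDT.average u) (ConsensusDT.piRho l2 lN) ∧
    ConsensusDT.ConvergesExpWithRate
      (G.acceleratedPiOutputs (ConsensusDT.acceleratedPiRho l2 lN)
        (ConsensusDT.acceleratedPiKI l2 lN) (ConsensusDT.acceleratedPiKp l2 lN) (fun _ => u))
      (ConsensusDT.average u) (ConsensusDT.acceleratedPiRho l2 lN) := ⟨G.plain_converges hG hl2 hlN, G.accelerated_converges hG hl2 hlN,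
    G.pi_converges hG hl2 hlN, G.acceleratedPi_converges hG hl2 hlN⟩
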